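/- Let $n\ge 5$. The necklace braid group $NB_n$ is the group generated by $\sigma_1,\dots,\sigma_n,\tau$ subject to the following relations, where the indices of the $\sigma$'s are taken modulo $n$: (B1) $\sigma_i\sigma_{i+1}\sigma_i=\sigma_{i+1}\sigma_i\sigma_{i+1}$ for all $i$; (B2) $\sigma_i\sigma_j=\sigma_j\sigma_i$ whenever $i-j\not\equiv\pm1\pmod n$; (N1) $\tau\sigma_i\tau^{-1}=\sigma_{i+1}$ for all $i$; (N2) $\tau^{2n}=1$. Let $B_n$ be Artin's braid group on $n$ strands, with standard generators $\sigma_1,\dots,\sigma_{n-1}$; it maps to $NB_n$ by the canonical homomorphism $\sigma_i\mapsto\sigma_i$ ($1\le i\le n-1$), whose image is the subgroup of $NB_n$ generated by $\sigma_1,\dots,\sigma_{n-1}$. The restriction $\rho|_{B_n}$ of a representation $\rho$ of $NB_n$ is its composition with this homomorphism. **Theorem.** Let $n\ge5$ and let $(\rho,V)$ be an irreducible complex representation of $NB_n$. If $\dim_{\mathbb C} V=n-2$, then the restriction $\rho|_{B_n}$ is also irreducible. -/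

import Mathlib

/-- The relators of Artin's presentation of the braid group on `n` strands. The generator with
index `i : Fin (n - 1)` (counted from `0`) is the one traditionally written `σ_{i+1}`. -/
def braidRels (n : ℕ) : Set (FreeGroup (Fin (n - 1))) :=
  {r | (∃ i j : Fin (n - 1), (i : ℕ) + 1 = j ∧
          r = (FreeGroup.of i * FreeGroup.of j * FreeGroup.of i) *
            (FreeGroup.of j * FreeGroup.of i * FreeGroup.of j)⁻¹) ∨
       (∃ i j : Fin (n - 1), (i : ℕ) + 1 < j ∧
          r = (FreeGroup.of i * FreeGroup.of j) * (FreeGroup.of j * FreeGroup.of i)⁻¹)}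

/-- Artin's braid group `B_n` on `n` strands. -/
abbrev BraidGroup (n : ℕ) : Type := PresentedGroup (braidRels n)

/-- Names of the generators of the necklace braid group. The indices of the `σ_i` are taken modulo
`n`; the traditional `σ_1, …, σ_n` are the `σ` of the residue classes of `1, …, n`. -/
inductive NecklaceGen (n : ℕ) : Type
  | sigma (i : ZMod n) : NecklaceGen n
  | tau : NecklaceGen n

/-- The generator `σ_i` in the free group. -/
def freeSigma {n : ℕ} (i : ZMod n) : FreeGroup (NecklaceGen n) :=
  FreeGroup.of (NecklaceGen.sigma i)

/-- The generator `τ` in the free group. -/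
def freeTau (n : ℕ) : FreeGroup (NecklaceGen n) :=
  FreeGroup.of NecklaceGen.tau

/-- The relators of the necklace braid group, for indices modulo `n`:
* `σ_i σ_{i+1} σ_i = σ_{i+1} σ_i σ_{i+1}`;
* `σ_i σ_j = σ_j σ_i` whenever `i - j` is neither `1` nor `-1` modulo `n`;
* `τ σ_i τ⁻¹ = σ_{i+1}`;
* `τ^{2n} = 1`. -/
def necklaceRels (n : ℕ) : Set (FreeGroup (NecklaceGen n)) :=
  {r | (∃ i : ZMod n,
          r = (freeSigma i * freeSigma (i + 1) * freeSigma i) *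
            (freeSigma (i + 1) * freeSigma i * freeSigma (i + 1))⁻¹) ∨
       (∃ i j : ZMod n, i - j ≠ 1 ∧ j - i ≠ 1 ∧
          r = (freeSigma i * freeSigma j) * (freeSigma j * freeSigma i)⁻¹) ∨
       (∃ i : ZMod n,
          r = (freeTau n * freeSigma i * (freeTau n)⁻¹) * (freeSigma (i + 1))⁻¹) ∨
       r = freeTau n ^ (2 * n)}

/-- The necklace braid group `NB_n`. -/
abbrev NecklaceBraidGroup (n : ℕ) : Type := PresentedGroup (necklaceRels n)

/-- The generator `σ_i` of the necklace braid group, with `i` modulo `n`. -/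
def necklaceSigma {n : ℕ} (i : ZMod n) : NecklaceBraidGroup n :=
  PresentedGroup.of (NecklaceGen.sigma i)

theorem necklaceSigma_braid {n : ℕ} (i : ZMod n) :
    necklaceSigma i * necklaceSigma (i + 1) * necklaceSigma i =
      necklaceSigma (i + 1) * necklaceSigma i * necklaceSigma (i + 1) := by
  have h := PresentedGroup.one_of_mem (rels := necklaceRels n)
    (x := (freeSigma i * freeSigma (i + 1) * freeSigma i) *
      (freeSigma (i + 1) * freeSigma i * freeSigma (i + 1))⁻¹) (Or.inl ⟨i, rfl⟩)
  rw [map_mul, map_inv, mul_inv_eq_one] at h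
  exact h

theorem necklaceSigma_comm {n : ℕ} (i j : ZMod n) (h₁ : i - j ≠ 1) (h₂ : j - i ≠ 1) :
    necklaceSigma i * necklaceSigma j = necklaceSigma j * necklaceSigma i := by
  have h := PresentedGroup.one_of_mem (rels := necklaceRels n)
    (x := (freeSigma i * freeSigma j) * (freeSigma j * freeSigma i)⁻¹)
    (Or.inr (Or.inl ⟨i, j, h₁, h₂, rfl⟩))
  rw [map_mul, map_inv, mul_inv_eq_one] at h
  exact h

/-- The image of a generator of `B_n` in `NB_n`: `σ_{i+1}` goes to `σ_{i+1}`. -/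
def braidGenImage (n : ℕ) (i : Fin (n - 1)) : NecklaceBraidGroup n :=
  necklaceSigma (((i : ℕ) + 1 : ℕ) : ZMod n)

theorem braidGenImage_rels (n : ℕ) :
    ∀ r ∈ braidRels n, FreeGroup.lift (braidGenImage n) r = 1 := by
  rintro r (⟨i, j, hij, rfl⟩ | ⟨i, j, hij, rfl⟩)
  · simp only [map_mul, map_inv, FreeGroup.lift_apply_of, mul_inv_eq_one]
    have hj : braidGenImage n j = necklaceSigma ((((i : ℕ) + 1 : ℕ) : ZMod n) + 1) := by
      unfold braidGenImage
      rw [← hij]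
      push_cast
      rfl
    rw [hj]
    exact necklaceSigma_braid _
  · simp only [map_mul, map_inv, FreeGroup.lift_apply_of, mul_inv_eq_one]
    have hj := j.isLt
    have key : ∀ m : ℕ, ((m : ℕ) : ZMod n) = 0 → m < n → m = 0 := fun m hm hlt =>
      Nat.eq_zero_of_dvd_of_lt ((ZMod.natCast_eq_zero_iff m n).1 hm) hlt
    refine necklaceSigma_comm _ _ (fun h => ?_) (fun h => ?_)
    · have := key ((j : ℕ) - i + 1) (by
        rw [Nat.cast_add, Nat.cast_sub (by omega)]
        push_cast at h ⊢
        linear_combination -h) (by omega)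
      omega
    · have := key ((j : ℕ) - i - 1) (by
        rw [Nat.cast_sub (by omega), Nat.cast_sub (by omega)]
        push_cast at h ⊢
        linear_combination h) (by omega)
      omega

/-- The canonical homomorphism `B_n → NB_n`, sending `σ_i` to `σ_i` for `1 ≤ i ≤ n - 1`. -/
def braidToNecklace (n : ℕ) : BraidGroup n →* NecklaceBraidGroup n :=
  PresentedGroup.toGroup (f := braidGenImage n) (braidGenImage_rels n)

/-- The image of `B_n` in `NB_n` is the subgroup generated by `σ_1, …, σ_{n-1}`. -/
theorem range_braidToNecklace (n : ℕ) :
    (braidToNecklace n).range =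
      Subgroup.closure (Set.range fun i : Fin (n - 1) =>
        necklaceSigma (((i : ℕ) + 1 : ℕ) : ZMod n)) := by
  rw [MonoidHom.range_eq_map, ← PresentedGroup.closure_range_of (braidRels n),
    MonoidHom.map_closure, ← Set.range_comp]
  congr 2

/-!
The key fact is `IsBraidTuple.eq_first_of_finrank_le`: a representation of the braid group on
`m + 1 ≥ 5` strands, over an algebraically closed field and of dimension at most `m - 2`, sends all
standard generators to the same operator. Its proof is an induction from `m - 2` to `m`, according
to the eigenspaces of the last generator `A`, which commutes with the first `m - 2` generators. An
eigenspace of dimension and codimension at least two is invariant under those generators, and the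
induction hypothesis applies on it and on the quotient by it. If some eigenspace has codimension at
most one, then all generators differ from a scalar by rank at most one, and unless they coincide,
a strictly decreasing chain of intersected kernels shows that the dimension is at least `m - 1`
(`IsBraidTuple.eq_first_of_finrank_range_sub_le_one`). If all eigenspaces are at most
one-dimensional, the centralizer of `A` consists of polynomials in `A`
(`exists_aeval_eq_of_commute`), so the first two generators commute and the braid relation makes
them equal.

If the generators agree on an invariant subspace and on the quotient by it, they agree on the whole
space (`IsBraidTuple.eq_first_of_invariant`); this is an elementary form of the fact that the
commutator subgroup of the braid group on at least five strands is perfect, so that it has no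
nontrivial action that is trivial on an invariant subspace and on the quotient by it.

Now let `V` be irreducible of dimension `n - 2` for the necklace braid group, and let `W` be a
proper nonzero subspace invariant under the braid group. Both `W` and `V ⧸ W` have dimension at
most `n - 3`, so the key fact with `m = n - 1` applies to them and all of `σ_1, …, σ_{n-1}` act on
`V` by one operator. Conjugation by `τ` shows that `σ_n` acts by the same operator and that it
commutes with `τ`, so `V` contains an invariant line
(`finrank_eq_one_of_necklaceSigma_eq`) and has dimension one, contradicting `n ≥ 5`.
-/

/-! ### Tuples satisfying the braid relations -/

/-- The operators `s 0, …, s (m - 1)` are invertible and satisfy the relations of the standard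
generators of the braid group on `m + 1` strands. The values `s i` with `m ≤ i` are ignored. -/
structure IsBraidTuple {K V : Type*} [Field K] [AddCommGroup V] [Module K V] (m : ℕ)
    (s : ℕ → Module.End K V) : Prop where
  isUnit : ∀ i < m, IsUnit (s i)
  comm : ∀ i j, i + 1 < j → j < m → s i * s j = s j * s i
  braid : ∀ i, i + 1 < m → s i * s (i + 1) * s i = s (i + 1) * s i * s (i + 1)

theorem eq_of_commute_of_braid {M : Type*} [Monoid M] {a b : M} (ha : IsUnit a) (hb : IsUnit b)
    (hc : a * b = b * a) (h : a * b * a = b * a * b) : a = b := by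
  rw [mul_assoc, ← hc, mul_assoc a b b] at h
  exact hb.mul_right_cancel (ha.mul_left_cancel h)

namespace IsBraidTuple

variable {K V : Type*} [Field K] [AddCommGroup V] [Module K V] {m : ℕ} {s : ℕ → Module.End K V}

theorem mono (h : IsBraidTuple m s) {k : ℕ} (hk : k ≤ m) : IsBraidTuple k s where
  isUnit i hi := h.isUnit i (by omega)
  comm i j hij hj := h.comm i j hij (by omega)
  braid i hi := h.braid i (by omega)

theorem adjacent_eq_of_commute (h : IsBraidTuple m s) {i : ℕ} (hi : i + 1 < m)
    (hc : s i * s (i + 1) = s (i + 1) * s i) : s i = s (i + 1) :=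
  eq_of_commute_of_braid (h.isUnit i (by omega)) (h.isUnit _ hi) hc (h.braid i hi)

theorem eq_first_of_adjacent_eq (h : IsBraidTuple m s) {k : ℕ} (hk : k + 1 < m)
    (hs : s k = s (k + 1)) : ∀ i < m, s i = s 0 := by
  have up : ∀ j, k + j + 1 < m → s (k + j) = s (k + j + 1) := by
    intro j
    induction j with
    | zero => exact fun _ => hs
    | succ j ih =>
      intro hj
      refine h.adjacent_eq_of_commute hj ?_
      have := h.comm (k + j) (k + j + 1 + 1) (by omega) (by omega)
      rwa [ih (by omega)] at this
  have down : ∀ j, j ≤ k → s (k - j) = s (k - j + 1) := by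
    intro j
    induction j with
    | zero => exact fun _ => hs
    | succ j ih =>
      intro hj
      have e : k - (j + 1) + 1 = k - j := by omega
      refine h.adjacent_eq_of_commute (by omega) ?_
      have := h.comm (k - (j + 1)) (k - j + 1) (by omega) (by omega)
      rwa [← ih (by omega), ← e] at this
  have adj : ∀ i, i + 1 < m → s i = s (i + 1) := by
    intro i hi
    rcases le_total k i with hki | hki
    · obtain ⟨j, rfl⟩ := Nat.exists_eq_add_of_le hki
      exact up j hi
    · have := down (k - i) (by omega)
      rwa [show k - (k - i) = i by omega] at this
  intro i
  induction i with
  | zero => exact fun _ => rfl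
  | succ i ih => exact fun hi => (adj i hi).symm.trans (ih (by omega))

/-- A neighbour of one of the two generators that commutes with the other one commutes with both,
hence equals its neighbour. -/
theorem eq_first_of_distant_eq (h : IsBraidTuple m s) (hm : 4 ≤ m) {i j : ℕ} (hij : i + 1 < j)
    (hj : j < m) (hs : s i = s j) : ∀ k < m, s k = s 0 := by
  by_cases hj' : j + 1 < m
  · refine h.eq_first_of_adjacent_eq hj' (h.adjacent_eq_of_commute hj' ?_)
    have := h.comm i (j + 1) (by omega) hj'
    rwa [hs] at this
  · rcases Nat.eq_zero_or_pos i with rfl | hi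
    · refine h.eq_first_of_adjacent_eq (k := 0) (by omega) (h.adjacent_eq_of_commute (by omega) ?_)
      have := h.comm 1 j (by omega) hj
      rw [← hs] at this
      exact this.symm
    · obtain ⟨i, rfl⟩ := Nat.exists_eq_add_of_le' hi
      refine h.eq_first_of_adjacent_eq (k := i) (by omega) (h.adjacent_eq_of_commute (by omega) ?_)
      have := h.comm i j (by omega) hj
      rwa [← hs] at this

theorem isConj (h : IsBraidTuple m s) : ∀ i < m, IsConj (s 0) (s i) := by
  intro i
  induction i with
  | zero => exact fun _ => IsConj.refl _
  | succ i ih =>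
    intro hi
    refine (ih (by omega)).trans ⟨((h.isUnit i (by omega)).mul (h.isUnit (i + 1) hi)).unit, ?_⟩
    have := h.braid i hi
    simpa [SemiconjBy, mul_assoc] using this

/-! ### Restriction to invariant subspaces and quotients -/

theorem restrict [FiniteDimensional K V] (h : IsBraidTuple m s) (W : Submodule K V)
    (r : ℕ → Module.End K W) (hr : ∀ i < m, ∀ w : W, (r i w : V) = s i w) : IsBraidTuple m r where
  isUnit i hi := by
    rw [LinearMap.isUnit_iff_ker_eq_bot, LinearMap.ker_eq_bot']
    intro w hw
    have hinj := LinearMap.ker_eq_bot'.1 ((LinearMap.isUnit_iff_ker_eq_bot _).1 (h.isUnit i hi))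
    exact Subtype.ext (hinj _ (by rw [← hr i hi, hw]; rfl))
  comm i j hij hj := by
    ext w
    have := congrArg (fun f : Module.End K V => f w) (h.comm i j hij hj)
    simpa [hr i (by omega), hr j hj] using this
  braid i hi := by
    ext w
    have := congrArg (fun f : Module.End K V => f w) (h.braid i hi)
    simpa [hr i (by omega), hr _ hi] using this

theorem quotient [FiniteDimensional K V] (h : IsBraidTuple m s) (W : Submodule K V)
    (r : ℕ → Module.End K (V ⧸ W)) (hr : ∀ i < m, ∀ v : V, r i (W.mkQ v) = W.mkQ (s i v)) :
    IsBraidTuple m r where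
  isUnit i hi := by
    rw [LinearMap.isUnit_iff_range_eq_top, LinearMap.range_eq_top]
    intro q
    obtain ⟨v, rfl⟩ := W.mkQ_surjective q
    have hsurj := LinearMap.range_eq_top.1 ((LinearMap.isUnit_iff_range_eq_top _).1 (h.isUnit i hi))
    obtain ⟨u, rfl⟩ := hsurj v
    exact ⟨W.mkQ u, hr i hi u⟩
  comm i j hij hj := by
    refine Submodule.linearMap_qext _ (LinearMap.ext fun v => ?_)
    have := congrArg (fun f : Module.End K V => W.mkQ (f v)) (h.comm i j hij hj)
    simpa [-Submodule.mkQ_apply, hr i (by omega), hr j hj] using this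
  braid i hi := by
    refine Submodule.linearMap_qext _ (LinearMap.ext fun v => ?_)
    have := congrArg (fun f : Module.End K V => W.mkQ (f v)) (h.braid i hi)
    simpa [-Submodule.mkQ_apply, hr i (by omega), hr _ hi] using this

/-- The differences `s 1 - s 0` and `s 3 - s 0` map `V` into `W` and kill `W`, so their products
vanish. Since `s 3` commutes with `s 0` and `s 1`, expanding `s 1 * s 3 = s 3 * s 1` around `s 0`
shows that `s 1` commutes with `s 0`. -/
theorem eq_first_of_invariant (h : IsBraidTuple m s) (hm : 4 ≤ m) (W : Submodule K V)
    (hsub : ∀ i < m, ∀ w ∈ W, s i w = s 0 w) (hquot : ∀ i < m, ∀ v, s i v - s 0 v ∈ W) :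
    ∀ i < m, s i = s 0 := by
  have hprod : ∀ i < m, ∀ j < m, (s i - s 0) * (s j - s 0) = 0 := fun i hi j hj =>
    LinearMap.ext fun v => by simpa [sub_eq_zero] using hsub i hi _ (hquot j hj v)
  have h13 := hprod 1 (by omega) 3 (by omega)
  have h31 := hprod 3 (by omega) 1 (by omega)
  have c03 := h.comm 0 3 (by omega) (by omega)
  have c13 := h.comm 1 3 (by omega) (by omega)
  refine h.eq_first_of_adjacent_eq (k := 0) (by omega) (h.adjacent_eq_of_commute (by omega) ?_)
  simp only [sub_mul, mul_sub] at h13 h31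
  rw [← sub_eq_zero] at c03 c13 ⊢
  have e : s 0 * s 1 - s 1 * s 0 = (s 1 * s 3 - s 0 * s 3 - (s 1 * s 0 - s 0 * s 0)) -
    (s 3 * s 1 - s 0 * s 1 - (s 3 * s 0 - s 0 * s 0)) - (s 1 * s 3 - s 3 * s 1) +
    (s 0 * s 3 - s 3 * s 0) := by abel
  show s 0 * s 1 - s 1 * s 0 = 0
  rw [e, h13, h31, c03, c13]
  simp

end IsBraidTuple

/-! ### Operators of rank at most one -/

section RankOne

variable {K V : Type*} [Field K] [AddCommGroup V] [Module K V] [FiniteDimensional K V]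

theorem finrank_range_mul_le_left (a b : Module.End K V) :
    Module.finrank K (LinearMap.range (a * b)) ≤ Module.finrank K (LinearMap.range a) :=
  Submodule.finrank_mono (LinearMap.range_comp_le_range b a)

theorem finrank_range_mul_le_right (a b : Module.End K V) :
    Module.finrank K (LinearMap.range (a * b)) ≤ Module.finrank K (LinearMap.range b) := by
  rw [Module.End.mul_eq_comp, LinearMap.range_comp]
  exact Submodule.finrank_map_le _ _

theorem exists_smulRight_of_finrank_range_le_one (x : Module.End K V)
    (hx : Module.finrank K (LinearMap.range x) ≤ 1) :
    ∃ (f : Module.Dual K V) (v : V), x = f.smulRight v := by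
  by_cases h0 : x = 0
  · exact ⟨0, 0, by simp [h0]⟩
  obtain ⟨u, hu⟩ : ∃ u, x u ≠ 0 := by
    by_contra! h
    exact h0 (LinearMap.ext h)
  obtain ⟨φ, hφ⟩ := Module.Projective.exists_dual_eq_one K hu
  obtain ⟨⟨v, hv⟩, hgen⟩ := finrank_le_one_iff.1 hx
  replace hgen : ∀ w, ∃ c : K, c • v = x w := fun w => by
    obtain ⟨c, hc⟩ := hgen ⟨x w, w, rfl⟩
    exact ⟨c, congrArg Subtype.val hc⟩
  obtain ⟨a, ha⟩ := hgen u
  refine ⟨φ ∘ₗ x, x u, LinearMap.ext fun w => ?_⟩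
  obtain ⟨c, hc⟩ := hgen w
  rw [← ha, map_smul, smul_eq_mul] at hφ
  rw [LinearMap.smulRight_apply, LinearMap.comp_apply, ← ha, ← hc, map_smul, smul_smul,
    smul_eq_mul, mul_assoc, mul_comm _ a, hφ, mul_one]

/-- Commuting operators of rank at most one with nonzero product are proportional, and the trace
determines the factor. -/
theorem eq_of_commute_of_finrank_range_le_one {x y : Module.End K V}
    (hx : Module.finrank K (LinearMap.range x) ≤ 1)
    (hy : Module.finrank K (LinearMap.range y) ≤ 1) (hc : x * y = y * x) (h0 : x * y ≠ 0)
    (htr : LinearMap.trace K V x = LinearMap.trace K V y) : x = y := by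
  obtain ⟨f, v, rfl⟩ := exists_smulRight_of_finrank_range_le_one x hx
  obtain ⟨g, u, rfl⟩ := exists_smulRight_of_finrank_range_le_one y hy
  have hc' : ∀ w, (g w * f u) • v = (f w * g v) • u := fun w => by
    simpa [smul_smul] using congrArg (fun e : Module.End K V => e w) hc
  obtain ⟨w, hw⟩ : ∃ w, (g w * f u) • v ≠ 0 := by
    by_contra! h
    exact h0 (LinearMap.ext fun w => by simpa [smul_smul] using h w)
  have hfu : f u ≠ 0 := fun h => hw (by simp [h])
  have hv : v ≠ 0 := fun h => hw (by simp [h])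
  have hfw : f w * g v ≠ 0 := fun h => hw (by rw [hc' w, h, zero_smul])
  obtain ⟨c, rfl⟩ : ∃ c : K, u = c • v :=
    ⟨(f w * g v)⁻¹ * (g w * f u), by rw [mul_smul, hc' w, smul_smul, inv_mul_cancel₀ hfw, one_smul]⟩
  have hg : ∀ w, g w * f v * c = f w * g v * c := fun w => by
    have := hc' w
    rw [smul_smul] at this
    have := smul_left_injective K hv this
    simpa [mul_assoc, mul_comm c] using this
  have hcv : c ≠ 0 ∧ f v ≠ 0 := by simpa using hfu
  simp only [LinearMap.trace_smulRight, map_smul, smul_eq_mul] at htr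
  ext w
  simp only [LinearMap.smulRight_apply, smul_smul]
  congr 1
  have := mul_right_cancel₀ hcv.1 (hg w)
  apply mul_right_cancel₀ hcv.2
  rw [mul_right_comm, this, mul_assoc, mul_comm (g v), ← htr]

end RankOne

/-- Under the braid relation for `x + μ` and `y + μ`, vanishing of `x * y` forces `x * x` and
`y * y` to vanish as well, after which the relation reads `μ ^ 2 • x = μ ^ 2 • y`. -/
theorem eq_of_mul_eq_zero_of_braid {K A : Type*} [Field K] [Ring A] [Algebra K A] {x y : A} {μ : K}
    (hx : IsUnit (x + μ • 1)) (hy : IsUnit (y + μ • 1)) (h0 : x * y = 0)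
    (hb : (x + μ • 1) * (y + μ • 1) * (x + μ • 1) = (y + μ • 1) * (x + μ • 1) * (y + μ • 1)) :
    x = y := by
  by_cases hμ : μ = 0
  · subst hμ
    rw [zero_smul, add_zero] at hx hy
    have hy0 : y = 0 := hx.mul_left_cancel (h0.trans (mul_zero x).symm)
    have hx0 : x = 0 := hy.mul_right_cancel (h0.trans (zero_mul y).symm)
    rw [hx0, hy0]
  have rel : μ • x + x * x = μ • y + y * y := by
    have h0' : y * x * y = 0 := by rw [mul_assoc, h0, mul_zero]
    simp only [mul_add, add_mul, smul_mul_assoc, mul_smul_comm, mul_one, one_mul, h0, h0',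
      zero_mul] at hb
    refine smul_right_injective A hμ ?_
    show μ • (μ • x + x * x) = μ • (μ • y + y * y)
    linear_combination (norm := module) hb
  have hxx : x * x = 0 := by
    refine hx.mul_left_cancel ?_
    have := congrArg (x * ·) rel
    simp only [mul_add, mul_smul_comm, h0, ← mul_assoc, zero_mul, smul_zero, add_zero] at this
    rw [mul_zero, add_mul, smul_mul_assoc, one_mul, ← mul_assoc, add_comm]
    exact this
  have hyy : y * y = 0 := by
    refine hy.mul_left_cancel ?_
    have := congrArg (· * y) rel
    simp only [add_mul, smul_mul_assoc, h0, mul_assoc, mul_zero, smul_zero, add_zero] at this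
    rw [mul_zero, add_mul, smul_mul_assoc, one_mul, add_comm]
    exact this.symm
  rw [hxx, hyy, add_zero, add_zero] at rel
  exact smul_right_injective A hμ rel

namespace IsBraidTuple

variable {K V : Type*} [Field K] [AddCommGroup V] [Module K V] [FiniteDimensional K V] {m : ℕ}
  {s : ℕ → Module.End K V}

/-- If the generators differ from a common scalar `μ` by operators `x i = s i - μ` of rank at most
one and are not all equal, then `x i * x j = 0` for distant indices and `x i * x (i + 1) ≠ 0`.
Hence the subspaces on which `x 0, …, x (k - 1)` vanish decrease strictly for `k < m`, which
needs dimension at least `m - 1`. -/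
theorem eq_first_of_finrank_range_sub_le_one (h : IsBraidTuple m s) (hm : 4 ≤ m)
    (hd : Module.finrank K V + 2 ≤ m) {l : ℕ} (hl : l < m) {μ : K}
    (hμ : Module.finrank K (LinearMap.range (s l - algebraMap K (Module.End K V) μ)) ≤ 1) :
    ∀ i < m, s i = s 0 := by
  by_contra hne
  set x : ℕ → Module.End K V := fun i => s i - algebraMap K (Module.End K V) μ with hx
  have hsx : ∀ i, s i = x i + algebraMap K (Module.End K V) μ := fun i => by simp [hx]
  have hconj : ∀ i < m, ∃ c : (Module.End K V)ˣ, x i = c * x l * (c⁻¹ : (Module.End K V)ˣ) := by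
    intro i hi
    obtain ⟨c, hc⟩ := (h.isConj l hl).symm.trans (h.isConj i hi)
    refine ⟨c, ?_⟩
    rw [Units.eq_mul_inv_iff_mul_eq]
    simp only [hx, sub_mul, mul_sub]
    rw [hc.eq, Algebra.commutes]
  have hrank : ∀ i < m, Module.finrank K (LinearMap.range (x i)) ≤ 1 := by
    intro i hi
    obtain ⟨c, hc⟩ := hconj i hi
    refine le_trans ?_ hμ
    rw [hc]
    exact (finrank_range_mul_le_left _ _).trans (finrank_range_mul_le_right _ _)
  have htr : ∀ i < m, LinearMap.trace K V (x i) = LinearMap.trace K V (x l) := by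
    intro i hi
    obtain ⟨c, hc⟩ := hconj i hi
    rw [hc, LinearMap.trace_conj]
  have hcomm : ∀ i j, i + 1 < j → j < m → x i * x j = x j * x i := by
    intro i j hij hj
    simp only [hx]
    exact ((Commute.sub_left (show Commute (s i) (s j) from h.comm i j hij hj)
      (Algebra.commute_algebraMap_left _ _)).sub_right (Algebra.commute_algebraMap_right _ _)).eq
  have hzero : ∀ i j, i + 1 < j → j < m → x i * x j = 0 := by
    intro i j hij hj
    by_contra h0
    refine hne (h.eq_first_of_distant_eq hm hij hj ?_)
    rw [hsx i, hsx j, eq_of_commute_of_finrank_range_le_one (hrank i (by omega)) (hrank j hj)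
      (hcomm i j hij hj) h0 ((htr i (by omega)).trans (htr j hj).symm)]
  have hadj : ∀ i, i + 1 < m → x i * x (i + 1) ≠ 0 := by
    intro i hi h0
    refine hne (h.eq_first_of_adjacent_eq hi ?_)
    have hui := h.isUnit i (by omega)
    have huj := h.isUnit (i + 1) hi
    have hb := h.braid i hi
    rw [hsx i, Algebra.algebraMap_eq_smul_one] at hui hb ⊢
    rw [hsx (i + 1), Algebra.algebraMap_eq_smul_one] at huj hb ⊢
    rw [eq_of_mul_eq_zero_of_braid hui huj h0 hb]
  let U : ℕ → Submodule K V := fun k => ⨅ i, ⨅ (_ : i < k), LinearMap.ker (x i)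
  have hU : ∀ k v, v ∈ U k ↔ ∀ i < k, x i v = 0 := fun k v => by
    simp [U, Submodule.mem_iInf]
  have hchain : ∀ k, k < m → Module.finrank K (U k) + k ≤ Module.finrank K V := by
    intro k
    induction k with
    | zero => exact fun _ => Submodule.finrank_le _
    | succ k ih =>
      intro hk
      obtain ⟨w, hw⟩ : ∃ w, x k (x (k + 1) w) ≠ 0 := by
        by_contra! h0
        exact hadj k hk (LinearMap.ext h0)
      have hlt : U (k + 1) < U k := by
        refine lt_of_le_of_ne (fun v hv => (hU k v).2 fun i hi => (hU _ v).1 hv i (by omega)) ?_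
        intro he
        have : x (k + 1) w ∈ U (k + 1) := he ▸ (hU k _).2 fun i hi =>
          congrArg (fun e : Module.End K V => e w) (hzero i (k + 1) (by omega) hk)
        exact hw ((hU _ _).1 this k (by omega))
      have := Submodule.finrank_lt_finrank_of_lt hlt
      have := ih (by omega)
      omega
  have := hchain (m - 1) (by omega)
  omega

end IsBraidTuple

/-! ### The centralizer of an operator with one-dimensional eigenspaces -/

section Centralizer

open Polynomial Module.End

variable {K : Type*} [Field K]

theorem coe_aeval_restrict_apply {V : Type*} [AddCommGroup V] [Module K V] (A : Module.End K V)
    (W : Submodule K V) (hW : ∀ w ∈ W, A w ∈ W) (p : K[X]) (w : W) :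
    (aeval (A.restrict hW) p w : V) = aeval A p w := by
  induction p using Polynomial.induction_on generalizing w with
  | C a => simp
  | add p q hp hq => simp [hp, hq]
  | monomial k a ih =>
    rw [pow_succ, ← mul_assoc, map_mul _ (C a * X ^ k), map_mul _ (C a * X ^ k),
      Module.End.mul_apply, ih]
    simp

/-- The proof is by induction on the dimension. For an eigenvalue `μ` of `A`, subtracting from `B`
a polynomial in `A` makes it vanish on the hyperplane `range (A - μ)`. The operators commuting
with `A` and vanishing there are determined up to a scalar, and one of them is `q(A)`, where
`(X - μ) * q` is the minimal polynomial of `A`. -/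
theorem exists_aeval_eq_of_commute [IsAlgClosed K] (n : ℕ) :
    ∀ {V : Type*} [AddCommGroup V] [Module K V] [FiniteDimensional K V] (A B : Module.End K V),
      Module.finrank K V = n → (∀ μ, Module.finrank K (eigenspace A μ) ≤ 1) → A * B = B * A →
      ∃ p : K[X], B = aeval A p := by
  induction n using Nat.strong_induction_on with
  | _ n ih =>
  intro V _ _ _ A B hn hA hAB
  rcases subsingleton_or_nontrivial V with hV | hV
  · exact ⟨0, LinearMap.ext fun v => Subsingleton.elim _ _⟩
  obtain ⟨μ, hμ⟩ := Module.End.exists_eigenvalue A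
  set N : Module.End K V := A - algebraMap K (Module.End K V) μ with hN
  have hXN : aeval A (X - C μ) = N := by simp [hN]
  have hNA : Commute N A := (Commute.refl A).sub_left (Algebra.commute_algebraMap_left _ _)
  have hNB : Commute N B := Commute.sub_left hAB (Algebra.commute_algebraMap_left _ _)
  have hker : LinearMap.ker N = eigenspace A μ := by
    rw [eigenspace_def, hN, Algebra.algebraMap_eq_smul_one]
  let W := LinearMap.range N
  have hdim : Module.finrank K W + Module.finrank K (LinearMap.ker N) = Module.finrank K V :=
    LinearMap.finrank_range_add_finrank_ker N
  have hpos : 0 < Module.finrank K (LinearMap.ker N) := by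
    rw [hker]
    exact Module.finrank_pos_iff.2 ((Submodule.nontrivial_iff_ne_bot).2 hμ)
  have hle : Module.finrank K (LinearMap.ker N) ≤ 1 := hker ▸ hA μ
  have hWinv : ∀ C : Module.End K V, Commute N C → ∀ w ∈ W, C w ∈ W := by
    rintro C hC _ ⟨v, rfl⟩
    exact ⟨C v, congrArg (fun e : Module.End K V => e v) hC.eq⟩
  obtain ⟨p, hp⟩ := ih (Module.finrank K W) (by omega) (A.restrict (hWinv A hNA))
    (B.restrict (hWinv B hNB)) rfl (fun ν => by
      refine le_trans ?_ (hA ν)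
      rw [← Submodule.finrank_map_subtype_eq]
      exact Submodule.finrank_mono (eigenspace_restrict_le_eigenspace A (hWinv A hNA) ν))
    (by
      ext w
      exact congrArg (fun e : Module.End K V => e w) hAB)
  set D := B - aeval A p with hD
  have hDN : D * N = 0 := by
    ext v
    have := congrArg (fun e : Module.End K W => (e ⟨N v, v, rfl⟩ : V)) hp
    simp only [coe_aeval_restrict_apply, LinearMap.coe_restrict_apply] at this
    simp [hD, this]
  have hND : N * D = 0 := by
    have : Commute N (aeval A p) := by
      rw [← hXN, commute_iff_eq, ← map_mul, ← map_mul, mul_comm]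
    rw [← hDN, ((show Commute N B from hNB).sub_right this).eq]
  obtain ⟨q, hq⟩ := dvd_iff_isRoot.2 (hasEigenvalue_iff_isRoot.1 hμ)
  have hint := Algebra.IsIntegral.isIntegral (R := K) A
  set Q := aeval A q with hQ
  have hNQ : N * Q = 0 := by rw [← hXN, hQ, ← map_mul, ← hq, minpoly.aeval]
  have hQN : Q * N = 0 := by rw [← hXN, hQ, ← map_mul, mul_comm, ← hq, minpoly.aeval]
  have hQ0 : Q ≠ 0 := by
    intro h0
    -- Otherwise the minimal polynomial of `A` divides its own proper factor `q`.
    have hq0 : q ≠ 0 := by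
      rintro rfl
      exact minpoly.ne_zero hint (by rw [hq, mul_zero])
    have h1 := natDegree_le_of_dvd (minpoly.dvd K A h0) hq0
    rw [hq, natDegree_mul (X_sub_C_ne_zero μ) hq0, natDegree_X_sub_C] at h1
    omega
  obtain ⟨x, hx⟩ : ∃ x, Q x ≠ 0 := by
    by_contra! h
    exact hQ0 (LinearMap.ext h)
  have hkill : ∀ C : Module.End K V, C * N = 0 → ∀ w ∈ W, C w = 0 := by
    rintro C hC _ ⟨v, rfl⟩
    exact congrArg (fun e : Module.End K V => e v) hC
  have hquot : Module.finrank K (V ⧸ W) = 1 := by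
    have := W.finrank_quotient_add_finrank
    omega
  have hx' : W.mkQ x ≠ 0 := fun h => hx (hkill Q hQN x (by simpa using h))
  have hmem : ∀ C : Module.End K V, N * C = 0 → ∀ v, C v ∈ LinearMap.ker N := fun C hC v =>
    congrArg (fun e : Module.End K V => e v) hC
  obtain ⟨c, hc⟩ := (finrank_eq_one_iff_of_nonzero' (⟨Q x, hmem Q hNQ x⟩ : LinearMap.ker N)
    (fun h => hx (congrArg Subtype.val h))).1 (le_antisymm hle hpos) ⟨D x, hmem D hND x⟩
  replace hc : c • Q x = D x := congrArg Subtype.val hc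
  refine ⟨p + C c * q, ?_⟩
  have hDQ : D = c • Q := by
    ext u
    obtain ⟨a, ha⟩ := (finrank_eq_one_iff_of_nonzero' _ hx').1 hquot (W.mkQ u)
    have hu : u - a • x ∈ W := by
      rw [← Submodule.ker_mkQ W, LinearMap.mem_ker, map_sub, map_smul, ha, sub_self]
    have h1 := hkill D hDN _ hu
    have h2 := hkill Q hQN _ hu
    rw [map_sub, map_smul, sub_eq_zero] at h1 h2
    rw [LinearMap.smul_apply, h1, h2, ← hc, smul_comm]
  rw [map_add, map_mul, aeval_C, ← Algebra.smul_def, ← hQ, ← hDQ, hD, add_sub_cancel]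

end Centralizer

/-! ### Representations of the braid group in low dimension -/

namespace IsBraidTuple

open Module.End

variable {K : Type*} [Field K]

theorem eq_first_of_restrict_of_quotient {V : Type*} [AddCommGroup V] [Module K V]
    [FiniteDimensional K V] {m : ℕ} {s : ℕ → Module.End K V} (h : IsBraidTuple m s) (hm : 4 ≤ m)
    (W : Submodule K V) (hW : ∀ i < m, ∀ w ∈ W, s i w ∈ W)
    (hsub : ∀ r : ℕ → Module.End K W, IsBraidTuple m r → ∀ i < m, r i = r 0)
    (hquot : ∀ r : ℕ → Module.End K (V ⧸ W), IsBraidTuple m r → ∀ i < m, r i = r 0) :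
    ∀ i < m, s i = s 0 := by
  classical
  let r : ℕ → Module.End K W := fun i =>
    if hi : ∀ w ∈ W, s i w ∈ W then (s i).restrict hi else 0
  let t : ℕ → Module.End K (V ⧸ W) := fun i =>
    if hi : W ≤ W.comap (s i) then W.mapQ W (s i) hi else 0
  have hr : ∀ i < m, ∀ w : W, (r i w : V) = s i w := fun i hi w => by
    simp only [r, dif_pos (hW i hi)]
    rfl
  have ht : ∀ i < m, ∀ v : V, t i (W.mkQ v) = W.mkQ (s i v) := fun i hi v => by
    simp only [t, dif_pos (show W ≤ W.comap (s i) from hW i hi)]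
    rfl
  refine h.eq_first_of_invariant hm W (fun i hi w hw => ?_) (fun i hi v => ?_)
  · have := hr i hi ⟨w, hw⟩
    rw [hsub r (h.restrict W r hr) i hi, hr 0 (by omega)] at this
    exact this.symm
  · have := ht i hi v
    rw [hquot t (h.quotient W t ht) i hi, ht 0 (by omega)] at this
    exact (Submodule.Quotient.eq W).1 this.symm

/-- A representation of the braid group on `m + 1 ≥ 5` strands of dimension at most `m - 2` sends
all standard generators to the same operator. The operators `s 0, …, s (m - 3)` commute with
`A = s (m - 1)`. If `A` has an eigenspace of dimension and codimension at least two, induction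
applies to these operators on the eigenspace and on the quotient by it. If `A` differs from a
scalar by an operator of rank at most one, `eq_first_of_finrank_range_sub_le_one` applies. Otherwise
all eigenspaces of `A` are at most one-dimensional and its centralizer is commutative. -/
theorem eq_first_of_finrank_le [IsAlgClosed K] (m : ℕ) (hm : 4 ≤ m) :
    ∀ {V : Type*} [AddCommGroup V] [Module K V] [FiniteDimensional K V]
      {s : ℕ → Module.End K V}, IsBraidTuple m s → Module.finrank K V + 2 ≤ m →
      ∀ i < m, s i = s 0 := by
  induction m using Nat.strong_induction_on with
  | _ m ih =>
  intro V _ _ _ s h hd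
  have hcomm : ∀ i < m - 2, s i * s (m - 1) = s (m - 1) * s i := fun i hi =>
    h.comm i (m - 1) (by omega) (by omega)
  by_cases hA : ∀ μ, Module.finrank K (eigenspace (s (m - 1)) μ) ≤ 1
  · obtain ⟨p, hp⟩ := exists_aeval_eq_of_commute _ (s (m - 1)) (s 0) rfl hA
      (hcomm 0 (by omega)).symm
    obtain ⟨q, hq⟩ := exists_aeval_eq_of_commute _ (s (m - 1)) (s 1) rfl hA
      (hcomm 1 (by omega)).symm
    refine h.eq_first_of_adjacent_eq (k := 0) (by omega) (h.adjacent_eq_of_commute (by omega) ?_)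
    show s 0 * s 1 = s 1 * s 0
    rw [hp, hq, ← map_mul, ← map_mul, mul_comm]
  push Not at hA
  obtain ⟨μ, hμ⟩ := hA
  set E := eigenspace (s (m - 1)) μ with hE
  have hquot := E.finrank_quotient_add_finrank
  by_cases hE2 : Module.finrank K E + 2 ≤ Module.finrank K V
  · have heq := (h.mono (k := m - 2) (by omega)).eq_first_of_restrict_of_quotient (by omega) E
      (fun i hi => mapsTo_genEigenspace_of_comm (show Commute _ _ from (hcomm i hi).symm) μ 1)
      (fun r hr => ih (m - 2) (by omega) (by omega) hr (by omega))
      (fun r hr => ih (m - 2) (by omega) (by omega) hr (by omega))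
    exact h.eq_first_of_adjacent_eq (k := 0) (by omega) (heq 1 (by omega)).symm
  · have hdim := LinearMap.finrank_range_add_finrank_ker
      (s (m - 1) - algebraMap K (Module.End K V) μ)
    rw [Algebra.algebraMap_eq_smul_one, ← eigenspace_def, ← hE,
      ← Algebra.algebraMap_eq_smul_one] at hdim
    exact h.eq_first_of_finrank_range_sub_le_one hm hd (l := m - 1) (μ := μ) (by omega) (by omega)

end IsBraidTuple

/-! ### The necklace braid group -/

theorem necklaceSigma_conj {n : ℕ} (i : ZMod n) :
    PresentedGroup.of NecklaceGen.tau * necklaceSigma i =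
      necklaceSigma (i + 1) * (PresentedGroup.of NecklaceGen.tau : NecklaceBraidGroup n) := by
  have h := PresentedGroup.one_of_mem (rels := necklaceRels n)
    (x := (freeTau n * freeSigma i * (freeTau n)⁻¹) * (freeSigma (i + 1))⁻¹)
    (Or.inr (Or.inr (Or.inl ⟨i, rfl⟩)))
  rw [map_mul, map_inv, mul_inv_eq_one, map_mul, map_inv, mul_inv_eq_iff_eq_mul, map_mul] at h
  exact h

theorem isBraidTuple_necklaceSigma {n : ℕ} {K V : Type*} [Field K] [AddCommGroup V] [Module K V]
    (ρ : Representation K (NecklaceBraidGroup n) V) :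
    IsBraidTuple (n - 1) fun i => ρ (necklaceSigma ((i + 1 : ℕ) : ZMod n)) where
  isUnit i _ := (Group.isUnit _).map ρ
  comm i j hij hj := by
    have := braidGenImage_rels n _ (Or.inr ⟨⟨i, by omega⟩, ⟨j, hj⟩, hij, rfl⟩)
    simp only [map_mul, map_inv, FreeGroup.lift_apply_of, mul_inv_eq_one] at this
    simp only [← map_mul]
    exact congrArg ρ this
  braid i hi := by
    have := braidGenImage_rels n _ (Or.inl ⟨⟨i, by omega⟩, ⟨i + 1, hi⟩, rfl, rfl⟩)
    simp only [map_mul, map_inv, FreeGroup.lift_apply_of, mul_inv_eq_one] at this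
    simp only [← map_mul]
    exact congrArg ρ this

theorem exists_common_eigenvector_of_mul_comm {K V : Type*} [Field K] [IsAlgClosed K]
    [AddCommGroup V] [Module K V] [FiniteDimensional K V] [Nontrivial V] {A T : Module.End K V}
    (h : A * T = T * A) : ∃ v : V, v ≠ 0 ∧ (∃ a : K, A v = a • v) ∧ ∃ b : K, T v = b • v := by
  obtain ⟨a, ha⟩ := Module.End.exists_eigenvalue A
  have hE : ∀ w ∈ Module.End.eigenspace A a, T w ∈ Module.End.eigenspace A a :=
    Module.End.mapsTo_genEigenspace_of_comm (show Commute _ _ from h) a 1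
  have : Nontrivial (Module.End.eigenspace A a) := Submodule.nontrivial_iff_ne_bot.2 ha
  obtain ⟨b, hb⟩ := Module.End.exists_eigenvalue (T.restrict hE)
  obtain ⟨v, hv⟩ := hb.exists_hasEigenvector
  exact ⟨v, fun h0 => hv.2 (Subtype.ext h0), ⟨a, Module.End.mem_eigenspace_iff.1 v.2⟩, b,
    congrArg Subtype.val hv.apply_eq_smul⟩

/-- If `σ_1` and `σ_2` act by the same operator `A`, conjugation by `τ` shows that all `σ_i` act by
`A` and that `τ` commutes with `A`. The action then has an invariant line. -/
theorem finrank_eq_one_of_necklaceSigma_eq {n : ℕ} [NeZero n] {K V : Type*} [Field K]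
    [IsAlgClosed K] [AddCommGroup V] [Module K V] [FiniteDimensional K V]
    (ρ : Representation K (NecklaceBraidGroup n) V) (hρ : ρ.IsIrreducible) [Nontrivial V]
    (h : ρ (necklaceSigma (1 + 1)) = ρ (necklaceSigma 1)) : Module.finrank K V = 1 := by
  have hconj : ∀ i : ZMod n, ρ (PresentedGroup.of NecklaceGen.tau) * ρ (necklaceSigma i) =
      ρ (necklaceSigma (i + 1)) * ρ (PresentedGroup.of NecklaceGen.tau) := fun i => by
    rw [← map_mul, ← map_mul, necklaceSigma_conj]
  have hunit : IsUnit (ρ (PresentedGroup.of NecklaceGen.tau)) := (Group.isUnit _).map ρ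
  have hcomm := hconj 1
  rw [h] at hcomm
  have hnat : ∀ j : ℕ, ρ (necklaceSigma (1 + (j : ZMod n))) = ρ (necklaceSigma 1) := by
    intro j
    induction j with
    | zero => simp
    | succ j ih =>
      refine hunit.mul_right_cancel ?_
      rw [← hcomm, ← ih, hconj, Nat.cast_succ, add_assoc]
  have hall : ∀ i : ZMod n, ρ (necklaceSigma i) = ρ (necklaceSigma 1) := fun i => by
    have := hnat (i - 1).val
    rwa [ZMod.natCast_zmod_val, add_sub_cancel] at this
  obtain ⟨v, hv, ⟨a, ha⟩, b, hb⟩ := exists_common_eigenvector_of_mul_comm hcomm.symm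
  have hline : ∀ g, ∃ c : K, ρ g v = c • v := by
    let H : Subgroup (NecklaceBraidGroup n) :=
      { carrier := {g | ∃ c : K, ρ g v = c • v}
        one_mem' := ⟨1, by simp⟩
        mul_mem' := by
          rintro g g' ⟨c, hc⟩ ⟨c', hc'⟩
          exact ⟨c' * c, by rw [map_mul, Module.End.mul_apply, hc', map_smul, hc, smul_smul]⟩
        inv_mem' := by
          rintro g ⟨c, hc⟩
          have hgv : v = c • ρ g⁻¹ v := by rw [← map_smul, ← hc, Representation.inv_self_apply]
          have hc0 : c ≠ 0 := fun h0 => hv (by rw [hgv, h0, zero_smul])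
          exact ⟨c⁻¹, by rw [eq_inv_smul_iff₀ hc0, ← hgv]⟩ }
    refine fun g => PresentedGroup.generated_by _ H (fun x => ?_) g
    cases x with
    | sigma i => exact ⟨a, by rw [← ha, ← hall i]; rfl⟩
    | tau => exact ⟨b, hb⟩
  let L : Subrepresentation ρ :=
    { toSubmodule := K ∙ v
      apply_mem_toSubmodule := fun g w hw => by
        obtain ⟨d, rfl⟩ := Submodule.mem_span_singleton.1 hw
        obtain ⟨c, hc⟩ := hline g
        rw [map_smul, hc]
        exact Submodule.smul_mem _ _ (Submodule.smul_mem _ _ (Submodule.mem_span_singleton_self v)) }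
  rcases hρ.eq_bot_or_eq_top L with hL | hL
  · exact absurd (Submodule.span_singleton_eq_bot.1 (congrArg Subrepresentation.toSubmodule hL)) hv
  · rw [← finrank_top, ← show (K ∙ v) = ⊤ from congrArg Subrepresentation.toSubmodule hL]
    exact finrank_span_singleton hv

theorem mainTheorem4 (n : ℕ) (hn : 5 ≤ n) (V : Type*) [AddCommGroup V] [Module ℂ V]
    (ρ : Representation ℂ (NecklaceBraidGroup n) V) (hρ : ρ.IsIrreducible)
    (hV : Module.finrank ℂ V = n - 2) :
    Representation.IsIrreducible (ρ.comp (braidToNecklace n)) := by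
  have : FiniteDimensional ℂ V := Module.finite_of_finrank_pos (by omega)
  have : Nontrivial V := Module.nontrivial_of_finrank_pos (R := ℂ) (by omega)
  have : NeZero n := ⟨by omega⟩
  have hnontriv : Nontrivial (Subrepresentation (ρ.comp (braidToNecklace n))) :=
    ⟨⊥, ⊤, fun h => bot_ne_top (congrArg Subrepresentation.toSubmodule h)⟩
  refine { eq_bot_or_eq_top := fun W => ?_ }
  by_contra! hW
  have hbot : W.toSubmodule ≠ ⊥ := fun h => hW.1 (Subrepresentation.toSubmodule_injective h)
  have htop : W.toSubmodule ≠ ⊤ := fun h => hW.2 (Subrepresentation.toSubmodule_injective h)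
  have hpos := Submodule.one_le_finrank_iff.2 hbot
  have hlt := Submodule.finrank_lt htop
  have hquot := W.toSubmodule.finrank_quotient_add_finrank
  have heq := (isBraidTuple_necklaceSigma ρ).eq_first_of_restrict_of_quotient (by omega)
    W.toSubmodule
    (fun i hi w hw => by
      have hi' : braidToNecklace n (PresentedGroup.of ⟨i, hi⟩) = braidGenImage n ⟨i, hi⟩ :=
        PresentedGroup.toGroup.of (braidGenImage_rels n)
      have := W.apply_mem_toSubmodule (PresentedGroup.of ⟨i, hi⟩) hw
      rwa [MonoidHom.comp_apply, hi'] at this)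
    (fun r hr => IsBraidTuple.eq_first_of_finrank_le _ (by omega) hr (by omega))
    (fun r hr => IsBraidTuple.eq_first_of_finrank_le _ (by omega) hr (by omega)) 1 (by omega)
  have := finrank_eq_one_of_necklaceSigma_eq ρ hρ (by simpa [one_add_one_eq_two] using heq)
  omega
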